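/- We work with typed proof nets of second-order, unit-free multiplicative exponential linear logic $\mathbf{meLL}$ with paragraph modality $\S$ (with mix and daimon). Links are $\mathsf{ax}$, $\mathsf{cut}$, $\otimes$, $\parr$, $\forall$, $\exists$, $\oc$, $\wn$ (of any arity, with discharged premises $\flat A$), $\S$, $\flat$ (premise $A$, conclusion $\flat A$) and $\mathsf{pax}$ (premise and conclusion $\flat A$). Each $\oc$ link is the principal port of exactly one box, each $\mathsf{pax}$ link is an auxiliary port of exactly one box, and distinct boxes are disjoint or nested. A net is a pre-net none of whose conclusions is discharged or contains an eigenvariable; a proof net is a net such that all the switchings of it, and of the content of each of its boxes, are acyclic. The depth of a link is the number of boxes containing it (the ports of a box are not contained in that box); the depth of an edge is the depth of the link of which it is a conclusion. * A proof net is in $\mathbf{mELL}$ if, for each $\flat$ link, the directed path from its conclusion through $\mathsf{pax}$ links to a $\wn$ link crosses exactly one $\mathsf{pax}$ link. * An indexing assigns an integer to each edge so that all conclusions of the net have the same index and, for every link, all its conclusions have one index $i$ and all its premises have index $i$, except that the premises of $\oc$, $\wn$ and $\S$ links have index $i+1$. A proof net is in $\mathbf{mL^3}$ if it has an indexing. It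 then has exactly one canonical indexing $I_0$: all values are nonnegative, and every connected component (of the underlying graph, all components having a conclusion of the net being counted as a single one) has an edge of index $0$. The level of a link is the value of $I_0$ on its conclusions. **Proposition.** Let $\pi$ be a $\mathbf{meLL}$ proof net. 1. If $\pi$ is in $\mathbf{mELL}$ and has no $\S$ link, then $\pi$ is in $\mathbf{mL^3}$. 2. The following are equivalent: (a) $\pi$ is in $\mathbf{mELL}$, $\pi$ has no $\S$ link, and every connected component of $\pi$ has an edge of depth $0$ (that is, no box contains a whole component); (b) $\pi$ is in $\mathbf{mL^3}$ and, for every link of $\pi$ that has a conclusion which is not a discharged formula, the level of the link equals its depth. In particular, for proof nets without $\S$ links and without components lying entirely inside a box, $\mathbf{mELL}$ is exactly the subsystem of $\mathbf{mL^3}$ in which levels and depths coincide. -/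

import Mathlib

/-! Second-order unit-free multiplicative exponential linear logic with the paragraph modality. -/

namespace MELL

/-- Formulas over the propositional variables `0, 1, 2, …`, up to renaming of bound variables:
`Formula n` has `n` available bound variables (de Bruijn indices, `0` being the innermost). -/
inductive Formula : ℕ → Type
  | var {n : ℕ} (X : ℕ) : Formula n
  | nvar {n : ℕ} (X : ℕ) : Formula n
  | bvar {n : ℕ} (i : Fin n) : Formula n
  | nbvar {n : ℕ} (i : Fin n) : Formula n
  | tensor {n : ℕ} (A B : Formula n) : Formula n
  | par {n : ℕ} (A B : Formula n) : Formula n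
  | bang {n : ℕ} (A : Formula n) : Formula n
  | quest {n : ℕ} (A : Formula n) : Formula n
  | ex {n : ℕ} (A : Formula (n + 1)) : Formula n
  | all {n : ℕ} (A : Formula (n + 1)) : Formula n
  | parag {n : ℕ} (A : Formula n) : Formula n

namespace Formula

/-- Linear negation, by the De Morgan laws. -/
def neg : {n : ℕ} → Formula n → Formula n
  | _, var X => nvar X
  | _, nvar X => var X
  | _, bvar i => nbvar i
  | _, nbvar i => bvar i
  | _, tensor A B => par B.neg A.neg
  | _, par A B => tensor B.neg A.neg
  | _, bang A => quest A.neg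
  | _, quest A => bang A.neg
  | _, ex A => all A.neg
  | _, all A => ex A.neg
  | _, parag A => parag A.neg

/-- Renaming of the bound variables. -/
def rename : {m n : ℕ} → (Fin m → Fin n) → Formula m → Formula n
  | _, _, _, var X => var X
  | _, _, _, nvar X => nvar X
  | _, _, r, bvar i => bvar (r i)
  | _, _, r, nbvar i => nbvar (r i)
  | _, _, r, tensor A B => tensor (A.rename r) (B.rename r)
  | _, _, r, par A B => par (A.rename r) (B.rename r)
  | _, _, r, bang A => bang (A.rename r)
  | _, _, r, quest A => quest (A.rename r)
  | _, _, r, ex A => ex (A.rename (Fin.cases 0 fun i => (r i).succ))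
  | _, _, r, all A => all (A.rename (Fin.cases 0 fun i => (r i).succ))
  | _, _, r, parag A => parag (A.rename r)

/-- Simultaneous capture-avoiding substitution for the bound variables; a negated variable is
replaced by the negation of the formula that is substituted. -/
def subst : {m n : ℕ} → (Fin m → Formula n) → Formula m → Formula n
  | _, _, _, var X => var X
  | _, _, _, nvar X => nvar X
  | _, _, s, bvar i => s i
  | _, _, s, nbvar i => (s i).neg
  | _, _, s, tensor A B => tensor (A.subst s) (B.subst s)
  | _, _, s, par A B => par (A.subst s) (B.subst s)
  | _, _, s, bang A => bang (A.subst s)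
  | _, _, s, quest A => quest (A.subst s)
  | _, _, s, ex A => ex (A.subst (Fin.cases (bvar 0) fun i => (s i).rename Fin.succ))
  | _, _, s, all A => all (A.subst (Fin.cases (bvar 0) fun i => (s i).rename Fin.succ))
  | _, _, s, parag A => parag (A.subst s)

/-- The body `A` of a quantified formula, with `B` substituted for the quantified variable. -/
def inst (A : Formula 1) (B : Formula 0) : Formula 0 := A.subst fun _ => B

/-- The variable `Z` occurs free in the formula. -/
def HasFree (Z : ℕ) : {n : ℕ} → Formula n → Prop
  | _, var X => X = Z
  | _, nvar X => X = Z
  | _, bvar _ => False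
  | _, nbvar _ => False
  | _, tensor A B => A.HasFree Z ∨ B.HasFree Z
  | _, par A B => A.HasFree Z ∨ B.HasFree Z
  | _, bang A => A.HasFree Z
  | _, quest A => A.HasFree Z
  | _, ex A => A.HasFree Z
  | _, all A => A.HasFree Z
  | _, parag A => A.HasFree Z

end Formula

/-- Labels of edges: formulas `A` and discharged formulas `♭A`. -/
inductive Label : Type
  | formula (A : Formula 0) : Label
  | flat (A : Formula 0) : Label

/-- The label is a discharged formula. -/
def Label.IsDischarged : Label → Prop
  | .formula _ => False
  | .flat _ => True

/-- The variable `Z` occurs free in the label. -/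
def Label.HasFree (Z : ℕ) : Label → Prop
  | .formula A => A.HasFree Z
  | .flat A => A.HasFree Z

/-- The kinds of links. A `forAll` link carries its eigenvariable, a `thereIs` link its associated
formula. -/
inductive LinkKind : Type
  | ax | cut | tensor | par | ofCourse | whyNot | flat | pax | paragraph
  | forAll (Z : ℕ)
  | thereIs (B : Formula 0)

open Label in
/-- `Typing k ps cs`: a link of kind `k` may have premises labelled `ps` and conclusions labelled
`cs`. -/
inductive Typing : LinkKind → List Label → List Label → Prop
  | ax (A : Formula 0) : Typing .ax [] [formula A.neg, formula A]
  | cut (A : Formula 0) : Typing .cut [formula A, formula A.neg] []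
  | tensor (A B : Formula 0) : Typing .tensor [formula A, formula B] [formula (A.tensor B)]
  | par (A B : Formula 0) : Typing .par [formula A, formula B] [formula (A.par B)]
  | ofCourse (A : Formula 0) : Typing .ofCourse [formula A] [formula A.bang]
  | whyNot (A : Formula 0) (k : ℕ) :
      Typing .whyNot (List.replicate k (flat A)) [formula A.quest]
  | flat (A : Formula 0) : Typing .flat [formula A] [flat A]
  | pax (A : Formula 0) : Typing .pax [flat A] [flat A]
  | paragraph (A : Formula 0) : Typing .paragraph [formula A] [formula A.parag]
  | forAll (A : Formula 1) (Z : ℕ) :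
      Typing (.forAll Z) [formula (A.inst (.var Z))] [formula A.all]
  | thereIs (A : Formula 1) (B : Formula 0) :
      Typing (.thereIs B) [formula (A.inst B)] [formula A.ex]

/-- Pre-nets. The box `b` consists of its border, made of the principal port `principal b` and the
auxiliary ports `aux b`, and of the pre-net which it contains, whose links are `content b`. -/
structure PreNet where
  Link : Type
  Edge : Type
  Box : Type
  finite_link : Finite Link
  finite_edge : Finite Edge
  finite_box : Finite Box
  kind : Link → LinkKind
  label : Edge → Label
  /-- the premises of a link -/
  prem : Link → List Edge
  /-- the conclusions of a link -/
  concl : Link → List Edge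
  /-- the link of which an edge is a conclusion -/
  src : Edge → Link
  mem_concl : ∀ e l, e ∈ concl l ↔ src e = l
  nodup_concl : ∀ l, (concl l).Nodup
  nodup_prem : ∀ l, (prem l).Nodup
  /-- an edge is the premise of at most one link -/
  prem_unique : ∀ e l m, e ∈ prem l → e ∈ prem m → l = m
  typing : ∀ l, Typing (kind l) ((prem l).map label) ((concl l).map label)
  /-- distinct `forAll` links have distinct eigenvariables -/
  eigen_unique : ∀ l m Z, kind l = .forAll Z → kind m = .forAll Z → l = m
  principal : Box → Link
  aux : Box → Set Link
  content : Box → Set Link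
  kind_principal : ∀ b, kind (principal b) = .ofCourse
  kind_aux : ∀ b, ∀ l ∈ aux b, kind l = .pax
  /-- the border of a box is outside of the pre-net contained in the box -/
  border_not_mem : ∀ b, ∀ l ∈ content b, l ≠ principal b ∧ l ∉ aux b
  /-- the pre-net contained in a box contains the premises of its links, and its conclusions are
  exactly the premises of the border -/
  src_mem_content : ∀ b l, l = principal b ∨ l ∈ aux b ∨ l ∈ content b →
    ∀ e ∈ prem l, src e ∈ content b
  content_out : ∀ b e, src e ∈ content b →
    ∃ l, e ∈ prem l ∧ (l = principal b ∨ l ∈ aux b ∨ l ∈ content b)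
  /-- each `ofCourse` link is the principal port of exactly one box -/
  box_of_ofCourse : ∀ l, kind l = .ofCourse → ∃! b, principal b = l
  /-- each `pax` link is in the border of exactly one box -/
  box_of_pax : ∀ l, kind l = .pax → ∃! b, l ∈ aux b
  /-- two distinct boxes are disjoint or included in one another -/
  nested : ∀ b c, b ≠ c →
    Disjoint ({principal b} ∪ aux b ∪ content b) ({principal c} ∪ aux c ∪ content c) ∨
    {principal b} ∪ aux b ∪ content b ⊆ {principal c} ∪ aux c ∪ content c ∨
    {principal c} ∪ aux c ∪ content c ⊆ {principal b} ∪ aux b ∪ content b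

namespace PreNet

variable (π : PreNet)

/-- All the links of a box: its border and its content. -/
def boxLinks (b : π.Box) : Set π.Link := {π.principal b} ∪ π.aux b ∪ π.content b

/-- The edge is a conclusion of the pre-net. -/
def IsConclusion (e : π.Edge) : Prop := ∀ l, e ∉ π.prem l

/-- The depth of a link: the number of boxes that contain it. -/
noncomputable def depth (l : π.Link) : ℕ := Nat.card {b : π.Box // l ∈ π.content b}

/-- A net: no conclusion is discharged or contains an eigenvariable. -/
def IsNet : Prop :=
  ∀ e, π.IsConclusion e → ¬ (π.label e).IsDischarged ∧
    ∀ l Z, π.kind l = .forAll Z → ¬ (π.label e).HasFree Z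

/-! ### Correctness

In what follows `S` is the set of links of a pre-net contained in `π`: either all the links of `π`,
or the content of one of its boxes. -/

/-- Jumping links: `par` links, `forAll` links, and `whyNot` links with at least one premise (so
that contraction is treated like `par`, as sequentialization requires). -/
def Jumping (l : π.Link) : Prop :=
  π.kind l = .par ∨ (∃ Z, π.kind l = .forAll Z) ∨ (π.kind l = .whyNot ∧ π.prem l ≠ [])

/-- The jumps of the jumping link `l`. -/
def jumps (S : Set π.Link) (l : π.Link) : Set π.Link :=
  {m | m ∈ S ∧ ((∃ e ∈ π.prem l, π.src e = m) ∨
    ∃ Z, π.kind l = .forAll Z ∧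
      ((∃ e, π.src e = m ∧ (π.label e).HasFree Z) ∨
        ∃ C, π.kind m = .thereIs C ∧ C.HasFree Z))}

/-- `j` chooses a jump for each jumping link. -/
def IsSwitching (S : Set π.Link) (j : π.Link → π.Link) : Prop :=
  ∀ l ∈ S, π.Jumping l → j l ∈ π.jumps S l

/-- The wires of a switching before boxes are collapsed: `inl e` is an edge `e` of the pre-net that
is kept, `inr l` is the new edge between a jumping link `l` and the chosen jump. -/
inductive Wire (S : Set π.Link) (j : π.Link → π.Link) : π.Edge ⊕ π.Link → π.Link → π.Link → Prop
  | edge (e : π.Edge) (l : π.Link) (hl : l ∈ S) (hs : π.src e ∈ S) (he : e ∈ π.prem l)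
      (hj : ¬ π.Jumping l) : Wire S j (.inl e) (π.src e) l
  | jump (l : π.Link) (hl : l ∈ S) (hj : π.Jumping l) : Wire S j (.inr l) (j l) l

/-- The link belongs to a box (content or border) of the pre-net on `S`. -/
def Collapsed (S : Set π.Link) (l : π.Link) : Prop :=
  ∃ b, π.boxLinks b ⊆ S ∧ l ∈ π.boxLinks b

/-- The node that `l` becomes when each box at depth zero is collapsed into one node: the set of
the links that are identified with `l`. -/
def node (S : Set π.Link) (l : π.Link) : Set π.Link :=
  {m | m = l ∨ ∃ b, π.boxLinks b ⊆ S ∧ l ∈ π.boxLinks b ∧ m ∈ π.boxLinks b}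

/-- The graph obtained by collapsing the boxes, without its loops and multiplicities. -/
def switchGraph (S : Set π.Link) (j : π.Link → π.Link) : SimpleGraph (Set π.Link) :=
  SimpleGraph.fromRel fun u v => ∃ w m l, π.Wire S j w m l ∧ u = π.node S m ∧ v = π.node S l

/-- The switching has no cycle. Cycles of length one and two are loops and pairs of parallel wires;
wires inside a collapsed box vanish, and the wires between a link and a collapsed box are replaced
by a single one. -/
def SwitchAcyclic (S : Set π.Link) (j : π.Link → π.Link) : Prop :=
  (π.switchGraph S j).IsAcyclic ∧
  (∀ w l, π.Wire S j w l l → π.Collapsed S l) ∧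
  (∀ w w' m l, π.Wire S j w m l → (π.Wire S j w' m l ∨ π.Wire S j w' l m) → w ≠ w' →
    π.Collapsed S m ∨ π.Collapsed S l)

/-- Correctness: all switchings of `π` and of the pre-nets contained in its boxes are acyclic. -/
def IsCorrect : Prop :=
  (∀ j, π.IsSwitching Set.univ j → π.SwitchAcyclic Set.univ j) ∧
  ∀ b j, π.IsSwitching (π.content b) j → π.SwitchAcyclic (π.content b) j

/-- Proof nets are correct nets. -/
def IsProofNet : Prop := π.IsNet ∧ π.IsCorrect

/-! ### Elementary linear logic -/

/-- `ExpPath e n w`: the directed path which starts with the edge `e` crosses `n` auxiliary ports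
and then ends in a premise of the `whyNot` link `w`. -/
inductive ExpPath : π.Edge → ℕ → π.Link → Prop
  | last (e : π.Edge) (w : π.Link) (hw : π.kind w = .whyNot) (he : e ∈ π.prem w) : ExpPath e 0 w
  | cross (e e' : π.Edge) (p w : π.Link) (n : ℕ) (hp : π.kind p = .pax) (he : e ∈ π.prem p)
      (he' : π.src e' = p) (h : ExpPath e' n w) : ExpPath e (n + 1) w

/-- Depth-stratification: each exponential branch crosses exactly one auxiliary port. -/
def DepthStratified : Prop :=
  ∀ e n w, π.kind (π.src e) = .flat → π.ExpPath e n w → n = 1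

/-- Multiplicative elementary linear logic. -/
def InMELL : Prop := π.IsProofNet ∧ π.DepthStratified

/-- No link is a `paragraph` link. -/
def ParagraphFree : Prop := ∀ l, π.kind l ≠ .paragraph

/-! ### Linear logic by levels -/

/-- The difference between the index of the premises and the index of the conclusions of a link. -/
def indexDrop : LinkKind → ℤ
  | .ofCourse => 1
  | .whyNot => 1
  | .paragraph => 1
  | _ => 0

/-- Weak indexings: all conclusions of a link have the same index `i`, and all its premises have
index `i`, or `i + 1` in the case of `ofCourse`, `whyNot` and `paragraph` links. -/
def IsWeakIndexing (I : π.Edge → ℤ) : Prop :=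
  ∀ l, ∃ i : ℤ, (∀ e ∈ π.concl l, I e = i) ∧ ∀ e ∈ π.prem l, I e = i + indexDrop (π.kind l)

/-- Indexings: moreover, all conclusions of the net have the same index. -/
def IsIndexing (I : π.Edge → ℤ) : Prop :=
  π.IsWeakIndexing I ∧ ∀ e e', π.IsConclusion e → π.IsConclusion e' → I e = I e'

/-- Multiplicative linear logic by levels. -/
def InML3 : Prop := π.IsProofNet ∧ ∃ I, π.IsIndexing I

/-- The edges are attached to the same link, or both are conclusions of the net. -/
def Touch (e e' : π.Edge) : Prop :=
  (∃ l, (e ∈ π.prem l ∨ e ∈ π.concl l) ∧ (e' ∈ π.prem l ∨ e' ∈ π.concl l)) ∨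
    (π.IsConclusion e ∧ π.IsConclusion e')

/-- The edges are in the same connected component, where all the connected components having a
conclusion are considered as one. -/
def Connected : π.Edge → π.Edge → Prop := Relation.EqvGen π.Touch

/-- Every connected component has an edge of depth zero. -/
def ComponentsMeetDepthZero : Prop := ∀ e, ∃ e', π.Connected e e' ∧ π.depth (π.src e') = 0

/-- Canonical indexings: all indexes are nonnegative and each component has an edge of index `0`. -/
def IsCanonical (I : π.Edge → ℤ) : Prop :=
  π.IsIndexing I ∧ (∀ e, ∃ e', π.Connected e e' ∧ I e' = 0) ∧ ∀ e, 0 ≤ I e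

variable {π}

theorem IsIndexing.sub_eq_of_connected {I J : π.Edge → ℤ} (hI : π.IsIndexing I)
    (hJ : π.IsIndexing J) {e e' : π.Edge} (h : π.Connected e e') : I e - J e = I e' - J e' := by
  induction h with
  | rel x y h =>
    rcases h with ⟨l, hx, hy⟩ | ⟨hx, hy⟩
    · obtain ⟨i, hi, hi'⟩ := hI.1 l
      obtain ⟨k, hk, hk'⟩ := hJ.1 l
      rcases hx with hx | hx <;> rcases hy with hy | hy <;>
        simp only [hi', hi, hk, hk', hx, hy] <;> ring
    · rw [hI.2 x y hx hy, hJ.2 x y hx hy]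
  | refl x => rfl
  | symm x y _ ih => exact ih.symm
  | trans x y z _ _ ih ih' => exact ih.trans ih'

/-- Every net with an indexing has exactly one canonical indexing. -/
theorem existsUnique_isCanonical (h : ∃ I, π.IsIndexing I) : ∃! I, π.IsCanonical I := by
  obtain ⟨I, hI⟩ := h
  have := π.finite_edge
  have key : ∀ e, ∃ m, (∃ e', π.Connected e e' ∧ I e' = m) ∧ ∀ e', π.Connected e e' → m ≤ I e' := by
    intro e
    obtain ⟨a, ha, ha'⟩ := Set.exists_min_image {e' | π.Connected e e'} I (Set.toFinite _)
      ⟨e, Relation.EqvGen.refl e⟩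
    exact ⟨I a, ⟨a, ha, rfl⟩, ha'⟩
  choose m hm hm' using key
  have hmc : ∀ e e', π.Connected e e' → m e = m e' := by
    have aux : ∀ e e', π.Connected e e' → m e ≤ m e' := by
      intro e e' h
      obtain ⟨a, ha, ha'⟩ := hm e'
      rw [← ha']
      exact hm' e a (h.trans _ _ _ ha)
    intro e e' h
    exact le_antisymm (aux e e' h) (aux e' e h.symm)
  have hJ : π.IsIndexing fun e => I e - m e := by
    refine ⟨fun l => ?_, fun e e' he he' => ?_⟩
    · obtain ⟨i, hi, hi'⟩ := hI.1 l
      by_cases hne : ∃ e₀, e₀ ∈ π.prem l ∨ e₀ ∈ π.concl l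
      · obtain ⟨e₀, he₀⟩ := hne
        refine ⟨i - m e₀, fun e he => ?_, fun e he => ?_⟩
        · beta_reduce
          rw [hi e he, hmc e e₀ (.rel _ _ (.inl ⟨l, .inr he, he₀⟩))]
        · beta_reduce
          rw [hi' e he, hmc e e₀ (.rel _ _ (.inl ⟨l, .inl he, he₀⟩))]
          ring
      · exact ⟨0, fun e he => (hne ⟨e, .inr he⟩).elim, fun e he => (hne ⟨e, .inl he⟩).elim⟩
    · beta_reduce
      rw [hI.2 e e' he he', hmc e e' (.rel _ _ (.inr ⟨he, he'⟩))]
  refine ⟨fun e => I e - m e, ⟨hJ, fun e => ?_, fun e => ?_⟩, ?_⟩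
  · obtain ⟨a, ha, ha'⟩ := hm e
    exact ⟨a, ha, by beta_reduce; rw [ha', hmc e a ha]; ring⟩
  · have := hm' e e (.refl e)
    linarith
  · rintro K ⟨hK, hK0, hKp⟩
    funext e
    obtain ⟨a, ha, ha'⟩ := hm e
    obtain ⟨b, hb, hb'⟩ := hK0 e
    have h1 := hK.sub_eq_of_connected hI ha
    have h2 := hK.sub_eq_of_connected hI hb
    have h3 := hKp a
    have h4 := hm' e b hb
    linarith

/-- The canonical indexing. The level of a link is the canonical index of its conclusions. -/
noncomputable def canonicalIndexing (h : π.InML3) : π.Edge → ℤ :=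
  (existsUnique_isCanonical h.2).choose

end PreNet

end MELL

namespace MELL

/-! Going up through a link, depth grows by one exactly at the ports of boxes (`ofCourse` and
`pax`), while an index grows by one exactly at `ofCourse`, `whyNot` and `paragraph`. Without
`paragraph` links, the two disagree only along exponential branches: depth grows at each `pax`, the
index once at the final `whyNot`. If every branch crosses one `pax`, that `pax` sits just below the
`flat` link and just above the `whyNot` link. Adding one to the depth of its conclusion moves the
jump from `pax` to `whyNot`, so `depthIndex` is an indexing. It is nonnegative, and when every
component reaches depth zero it takes the value zero in each of them; uniqueness then makes it the
canonical indexing.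

Conversely, suppose that level and depth agree on undischarged edges. A `paragraph` link would
change the level but not the depth. A branch crossing `n` `pax` links changes depth by `n` and level
by one, so `n = 1`. Finally, an edge of level zero cannot be discharged, hence has depth zero. -/

theorem Typing.isDischarged_prem_iff {k : LinkKind} {ps cs : List Label} (h : Typing k ps cs)
    {x : Label} (hx : x ∈ ps) : x.IsDischarged ↔ k = .whyNot ∨ k = .pax := by
  cases h <;> simp_all [Label.IsDischarged]
  all_goals rcases hx with rfl | rfl <;> simp

theorem Typing.isDischarged_concl_iff {k : LinkKind} {ps cs : List Label} (h : Typing k ps cs)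
    {x : Label} (hx : x ∈ cs) : x.IsDischarged ↔ k = .flat ∨ k = .pax := by
  cases h <;> simp_all [Label.IsDischarged]
  all_goals rcases hx with rfl | rfl <;> simp

theorem Typing.prem_ne_nil {k : LinkKind} {ps cs : List Label} (h : Typing k ps cs)
    (hk : k = .flat ∨ k = .pax ∨ k = .paragraph) : ps ≠ [] := by
  cases h <;> simp_all

theorem Typing.concl_ne_nil {k : LinkKind} {ps cs : List Label} (h : Typing k ps cs)
    (hk : k ≠ .cut) : cs ≠ [] := by
  cases h <;> simp_all

namespace PreNet

variable {π : PreNet}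

theorem isDischarged_iff_of_mem_prem {e : π.Edge} {l : π.Link} (h : e ∈ π.prem l) :
    (π.label e).IsDischarged ↔ π.kind l = .whyNot ∨ π.kind l = .pax :=
  (π.typing l).isDischarged_prem_iff (List.mem_map_of_mem h)

theorem isDischarged_iff_src (e : π.Edge) :
    (π.label e).IsDischarged ↔ π.kind (π.src e) = .flat ∨ π.kind (π.src e) = .pax :=
  (π.typing _).isDischarged_concl_iff (List.mem_map_of_mem ((π.mem_concl e _).2 rfl))

theorem exists_mem_prem {l : π.Link}
    (h : π.kind l = .flat ∨ π.kind l = .pax ∨ π.kind l = .paragraph) : ∃ e, e ∈ π.prem l :=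
  List.exists_mem_of_ne_nil _ fun h0 => (π.typing l).prem_ne_nil h (by simp [h0])

theorem exists_src_eq {l : π.Link} (h : π.kind l ≠ .cut) : ∃ e, π.src e = l := by
  obtain ⟨e, he⟩ := List.exists_mem_of_ne_nil (π.concl l)
    fun h0 => (π.typing l).concl_ne_nil h (by simp [h0])
  exact ⟨e, (π.mem_concl e l).1 he⟩

/-! ### Depth across a link -/

theorem src_mem_content_iff {e : π.Edge} {l : π.Link} (he : e ∈ π.prem l) (b : π.Box) :
    π.src e ∈ π.content b ↔ l = π.principal b ∨ l ∈ π.aux b ∨ l ∈ π.content b := by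
  refine ⟨fun h => ?_, fun h => π.src_mem_content b l h e he⟩
  obtain ⟨m, hm, h⟩ := π.content_out b e h
  exact π.prem_unique e l m he hm ▸ h

/-- The premises of a link which is not a port of a box have the depth of the link. -/
theorem depth_src_of_not_port {e : π.Edge} {l : π.Link} (he : e ∈ π.prem l)
    (h : π.kind l ≠ .ofCourse) (h' : π.kind l ≠ .pax) : π.depth (π.src e) = π.depth l := by
  have key : ∀ b, π.src e ∈ π.content b ↔ l ∈ π.content b := fun b => by
    rw [src_mem_content_iff he]
    refine ⟨?_, fun h => .inr (.inr h)⟩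
    rintro (rfl | hb | hb)
    · exact (h (π.kind_principal b)).elim
    · exact (h' (π.kind_aux b l hb)).elim
    · exact hb
  simp only [depth, key]

/-- The premises of a port of a box are one level deeper than the port. -/
theorem depth_src_of_port {e : π.Edge} {l : π.Link} (he : e ∈ π.prem l)
    (h : π.kind l = .ofCourse ∨ π.kind l = .pax) : π.depth (π.src e) = π.depth l + 1 := by
  have := π.finite_box
  -- The kind of `l` decides whether it is a principal or an auxiliary port, so it borders a single
  -- box: the only one entered on passing to the premise.
  obtain ⟨b, hb, hu⟩ : ∃ b, (l = π.principal b ∨ l ∈ π.aux b) ∧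
      ∀ c, l = π.principal c ∨ l ∈ π.aux c → c = b := by
    rcases h with h | h
    · obtain ⟨b, hb, hu⟩ := π.box_of_ofCourse l h
      refine ⟨b, .inl hb.symm, ?_⟩
      rintro c (hc | hc)
      · exact hu c hc.symm
      · exact absurd ((π.kind_aux c l hc).symm.trans h) (by simp)
    · obtain ⟨b, hb, hu⟩ := π.box_of_pax l h
      refine ⟨b, .inr hb, ?_⟩
      rintro c (rfl | hc)
      · exact absurd ((π.kind_principal c).symm.trans h) (by simp)
      · exact hu c hc
  have hset : {c | π.src e ∈ π.content c} = insert b {c | l ∈ π.content c} := by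
    ext c
    simp only [Set.mem_ofPred_eq, Set.mem_insert_iff, src_mem_content_iff he, ← or_assoc]
    refine or_congr ⟨hu c, ?_⟩ Iff.rfl
    rintro rfl
    exact hb
  have hb' : b ∉ {c | l ∈ π.content c} := fun hc => by
    have := π.border_not_mem b l hc
    tauto
  exact (congrArg Set.ncard hset).trans (Set.ncard_insert_of_notMem hb' (Set.toFinite _))

theorem depth_le_card_box (l : π.Link) : π.depth l ≤ Nat.card π.Box :=
  have := π.finite_box
  Nat.card_le_card_of_injective _ Subtype.val_injective

theorem IsConclusion.depth_src {e : π.Edge} (h : π.IsConclusion e) : π.depth (π.src e) = 0 := by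
  have : IsEmpty {b : π.Box // π.src e ∈ π.content b} := ⟨fun ⟨b, hb⟩ => by
    obtain ⟨l, hl, -⟩ := π.content_out b e hb
    exact h l hl⟩
  exact Nat.card_of_isEmpty

/-! ### Exponential branches -/

theorem IsNet.exists_mem_prem (hπ : π.IsNet) {e : π.Edge} (h : (π.label e).IsDischarged) :
    ∃ l, e ∈ π.prem l ∧ (π.kind l = .whyNot ∨ π.kind l = .pax) := by
  by_contra! h'
  refine (hπ e fun l hl => ?_).1 h
  have h1 := (isDischarged_iff_of_mem_prem hl).1 h
  have h2 := h' l hl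
  tauto

/-- In a net every discharged edge starts a path to a `whyNot` link. -/
theorem IsNet.exists_expPath (hπ : π.IsNet) {e : π.Edge} (h : (π.label e).IsDischarged) :
    ∃ n w, π.ExpPath e n w := by
  -- Each `pax` crossed downwards leaves a box, so the depth strictly decreases.
  induction hd : π.depth (π.src e) using Nat.strong_induction_on generalizing e with
  | _ d ih =>
    obtain ⟨l, hl, hk | hk⟩ := hπ.exists_mem_prem h
    · exact ⟨0, l, .last e l hk hl⟩
    · obtain ⟨e', rfl⟩ := exists_src_eq (l := l) (by simp [hk])
      have := depth_src_of_port hl (.inr hk)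
      obtain ⟨n, w, hp⟩ := ih _ (by omega) ((isDischarged_iff_src e').2 (.inr hk)) rfl
      exact ⟨n + 1, w, .cross e e' _ w n hk hl rfl hp⟩

/-- A path which starts at an auxiliary port can be extended backwards to a `flat` link. -/
theorem ExpPath.exists_flat {e : π.Edge} {n : ℕ} {w : π.Link} (h : π.ExpPath e n w)
    (he : π.kind (π.src e) = .pax) :
    ∃ e₀ m, n < m ∧ π.kind (π.src e₀) = .flat ∧ π.ExpPath e₀ m w := by
  -- Going backwards the depth increases, and the number of boxes bounds it.
  induction hd : Nat.card π.Box - π.depth (π.src e) using Nat.strong_induction_on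
    generalizing e n with
  | _ d ih =>
    obtain ⟨e₁, he₁⟩ := PreNet.exists_mem_prem (.inr (.inl he))
    have hp : π.ExpPath e₁ (n + 1) w := .cross e₁ e _ w n he he₁ rfl h
    rcases (isDischarged_iff_src e₁).1 ((isDischarged_iff_of_mem_prem he₁).2 (.inr he)) with hf | hf
    · exact ⟨e₁, n + 1, n.lt_succ_self, hf, hp⟩
    · have h1 := depth_src_of_port he₁ (.inr he)
      have h2 := depth_le_card_box (π.src e₁)
      obtain ⟨e₀, m, hm, h0, hp'⟩ := ih _ (by omega) hp hf rfl
      exact ⟨e₀, m, by omega, h0, hp'⟩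

theorem ExpPath.depth_src {e : π.Edge} {n : ℕ} {w : π.Link} (h : π.ExpPath e n w) :
    π.depth (π.src e) = π.depth w + n := by
  induction h with
  | last e w hw he => exact depth_src_of_not_port he (by simp [hw]) (by simp [hw])
  | cross e e' p w n hp he he' h ih =>
    subst he'
    rw [depth_src_of_port he (.inr hp), ih, add_assoc]

theorem IsWeakIndexing.eq_of_mem_prem {I : π.Edge → ℤ} (hI : π.IsWeakIndexing I) {e e' : π.Edge}
    (h : e ∈ π.prem (π.src e')) : I e = I e' + indexDrop (π.kind (π.src e')) := by
  obtain ⟨i, hi, hi'⟩ := hI (π.src e')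
  rw [hi' e h, hi e' ((π.mem_concl _ _).2 rfl)]

/-- Indexes are constant along exponential branches, up to the final `whyNot` link. -/
theorem ExpPath.exists_index {I : π.Edge → ℤ} (hI : π.IsWeakIndexing I) {e : π.Edge} {n : ℕ}
    {w : π.Link} (h : π.ExpPath e n w) :
    ∃ f, π.src f = w ∧ ¬ (π.label f).IsDischarged ∧ I e = I f + 1 := by
  induction h with
  | last e w hw he =>
    obtain ⟨f, rfl⟩ := exists_src_eq (l := w) (by simp [hw])
    refine ⟨f, rfl, by simp [isDischarged_iff_src, hw], ?_⟩
    rw [hI.eq_of_mem_prem he, hw, indexDrop]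
  | cross e e' p w n hp he he' h ih =>
    subst he'
    obtain ⟨f, hf, hf', hIf⟩ := ih
    exact ⟨f, hf, hf', by rw [hI.eq_of_mem_prem he, hp, ← hIf]; simp [indexDrop]⟩

/-- In a depth-stratified net the conclusions of auxiliary ports are premises of `whyNot` links. -/
theorem DepthStratified.whyNot_of_pax (hs : π.DepthStratified) (hπ : π.IsNet) {e : π.Edge}
    {l : π.Link} (hl : e ∈ π.prem l) (he : π.kind (π.src e) = .pax) : π.kind l = .whyNot := by
  refine ((isDischarged_iff_of_mem_prem hl).1 ((isDischarged_iff_src e).2 (.inr he))).resolve_right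
    fun hk => ?_
  obtain ⟨e', rfl⟩ := exists_src_eq (l := l) (by simp [hk])
  obtain ⟨n, w, hp⟩ := hπ.exists_expPath ((isDischarged_iff_src e').2 (.inr hk))
  -- Two consecutive `pax` links would lie on a branch with at least two crossings.
  obtain ⟨e₀, m, hm, h0, hp'⟩ := (ExpPath.cross e e' _ w n hk hl rfl hp).exists_flat he
  have := hs e₀ m w h0 hp'
  omega

/-! ### The indexing given by depths -/

open Classical in
/-- The depth of the source of an edge, corrected by one for the conclusions of auxiliary ports. -/
noncomputable def depthIndex (π : PreNet) (e : π.Edge) : ℤ :=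
  π.depth (π.src e) + if π.kind (π.src e) = .pax then 1 else 0

theorem depthIndex_of_ne_pax {e : π.Edge} (h : π.kind (π.src e) ≠ .pax) :
    π.depthIndex e = π.depth (π.src e) := by
  simp [depthIndex, h]

theorem depthIndex_of_not_isDischarged {e : π.Edge} (h : ¬ (π.label e).IsDischarged) :
    π.depthIndex e = π.depth (π.src e) :=
  depthIndex_of_ne_pax fun hk => h ((isDischarged_iff_src e).2 (.inr hk))

theorem depthIndex_of_pax {e : π.Edge} (h : π.kind (π.src e) = .pax) :
    π.depthIndex e = π.depth (π.src e) + 1 := by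
  simp [depthIndex, h]

theorem isIndexing_depthIndex (hπ : π.IsNet) (hs : π.DepthStratified) (hp : π.ParagraphFree) :
    π.IsIndexing π.depthIndex := by
  classical
  refine ⟨fun l => ⟨π.depth l + if π.kind l = .pax then 1 else 0, fun e he => ?_, fun e he => ?_⟩,
    fun e e' he he' => ?_⟩
  · rw [← (π.mem_concl e l).1 he, depthIndex]
  · have hd := isDischarged_iff_of_mem_prem he
    by_cases hw : π.kind l = .whyNot
    · rcases (isDischarged_iff_src e).1 (hd.2 (.inl hw)) with hf | hf
      -- A `flat` link directly above a `whyNot` would be a branch with no crossing.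
      · exact absurd (hs e 0 l hf (.last e l hw he)) zero_ne_one
      · rw [depthIndex_of_pax hf, depth_src_of_not_port he (by simp [hw]) (by simp [hw])]
        simp [hw, indexDrop]
    · rw [depthIndex_of_ne_pax fun hf => hw (hs.whyNot_of_pax hπ he hf)]
      by_cases hport : π.kind l = .ofCourse ∨ π.kind l = .pax
      · rw [depth_src_of_port he hport]
        rcases hport with h | h <;> simp [h, indexDrop]
      · push Not at hport
        rw [depth_src_of_not_port he hport.1 hport.2]
        have hp' := hp l
        cases hk : π.kind l <;> simp_all [indexDrop]
  · rw [depthIndex_of_not_isDischarged (hπ e he).1, depthIndex_of_not_isDischarged (hπ e' he').1,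
      he.depth_src, he'.depth_src]

theorem isCanonical_depthIndex (hπ : π.IsNet) (hs : π.DepthStratified) (hp : π.ParagraphFree)
    (hc : π.ComponentsMeetDepthZero) : π.IsCanonical π.depthIndex := by
  refine ⟨isIndexing_depthIndex hπ hs hp, fun e => ?_, fun e => ?_⟩
  · obtain ⟨e', hee', h0⟩ := hc e
    -- A `pax` conclusion at depth zero has index 1; the conclusion of the `whyNot` below it has the
    -- same depth and index 0.
    by_cases hk : π.kind (π.src e') = .pax
    · obtain ⟨l, hl, -⟩ := hπ.exists_mem_prem ((isDischarged_iff_src e').2 (.inr hk))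
      have hw := hs.whyNot_of_pax hπ hl hk
      obtain ⟨f, rfl⟩ := exists_src_eq (l := l) (by simp [hw])
      refine ⟨f, hee'.trans _ _ _
        (.rel _ _ (.inl ⟨_, .inl hl, .inr ((π.mem_concl _ _).2 rfl)⟩)), ?_⟩
      rw [depthIndex_of_ne_pax (by simp [hw]),
        ← depth_src_of_not_port hl (by simp [hw]) (by simp [hw]), h0, Nat.cast_zero]
    · exact ⟨e', hee', by rw [depthIndex_of_ne_pax hk, h0, Nat.cast_zero]⟩
  · unfold depthIndex
    positivity

theorem isCanonical_canonicalIndexing (h : π.InML3) : π.IsCanonical (canonicalIndexing h) :=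
  (existsUnique_isCanonical h.2).choose_spec.1

theorem canonicalIndexing_eq (h : π.InML3) {I : π.Edge → ℤ} (hI : π.IsCanonical I) :
    canonicalIndexing h = I :=
  (existsUnique_isCanonical h.2).unique (isCanonical_canonicalIndexing h) hI

/-! ### Consequences of equality of levels and depths -/

section LevelEqDepth

variable {I : π.Edge → ℤ}

theorem IsWeakIndexing.paragraphFree (hI : π.IsWeakIndexing I)
    (h : ∀ e, ¬ (π.label e).IsDischarged → I e = π.depth (π.src e)) : π.ParagraphFree := by
  intro l hl
  obtain ⟨e, he⟩ := PreNet.exists_mem_prem (.inr (.inr hl))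
  obtain ⟨f, rfl⟩ := exists_src_eq (l := l) (by simp [hl])
  have h1 := h e (by simp [isDischarged_iff_of_mem_prem he, hl])
  have h2 := h f (by simp [isDischarged_iff_src, hl])
  have h3 := hI.eq_of_mem_prem he
  rw [h1, h2, depth_src_of_not_port he (by simp [hl]) (by simp [hl]), hl, indexDrop] at h3
  omega

/-- Compare the undischarged edges at the two ends of a branch: the premise of the `flat` link and
the conclusion of the `whyNot` link. Their depths differ by `n`, their indices by one. -/
theorem IsWeakIndexing.depthStratified (hI : π.IsWeakIndexing I)
    (h : ∀ e, ¬ (π.label e).IsDischarged → I e = π.depth (π.src e)) : π.DepthStratified := by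
  intro e n w hf hp
  obtain ⟨f, rfl, hf', hIf⟩ := hp.exists_index hI
  obtain ⟨a, ha⟩ := PreNet.exists_mem_prem (.inl hf)
  have h1 := h a (by simp [isDischarged_iff_of_mem_prem ha, hf])
  have h2 := hI.eq_of_mem_prem ha
  have h3 := hp.depth_src
  rw [h1, depth_src_of_not_port ha (by simp [hf]) (by simp [hf]), hf, hIf, h f hf', indexDrop] at h2
  · omega
  -- Side conditions of the default case of `indexDrop`.
  all_goals simp

theorem IsCanonical.componentsMeetDepthZero (hI : π.IsCanonical I) (hπ : π.IsNet)
    (h : ∀ e, ¬ (π.label e).IsDischarged → I e = π.depth (π.src e)) :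
    π.ComponentsMeetDepthZero := by
  intro e
  obtain ⟨e', hee', h0⟩ := hI.2.1 e
  by_cases hd : (π.label e').IsDischarged
  -- A discharged edge of index 0 would force index -1 below the `whyNot` that ends its branch.
  · obtain ⟨n, w, hp⟩ := hπ.exists_expPath hd
    obtain ⟨f, -, -, hf⟩ := hp.exists_index hI.1.1
    have := hI.2.2 f
    omega
  · have := h e' hd
    exact ⟨e', hee', by omega⟩

end LevelEqDepth

end PreNet

end MELL

theorem mainTheorem7 (π : MELL.PreNet) (hπ : π.IsProofNet) :
    (π.InMELL ∧ π.ParagraphFree → π.InML3) ∧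
    (π.InMELL ∧ π.ParagraphFree ∧ π.ComponentsMeetDepthZero ↔
      ∃ h : π.InML3, ∀ l, ∀ e ∈ π.concl l, ¬ (π.label e).IsDischarged →
        MELL.PreNet.canonicalIndexing h e = (π.depth l : ℤ)) := by
  have h1 : π.InMELL ∧ π.ParagraphFree → π.InML3 := fun ⟨hm, hp⟩ =>
    ⟨hπ, _, MELL.PreNet.isIndexing_depthIndex hπ.1 hm.2 hp⟩
  refine ⟨h1, fun ⟨hm, hp, hc⟩ => ⟨h1 ⟨hm, hp⟩, fun l e he hd => ?_⟩, fun ⟨h, hl⟩ => ?_⟩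
  · rw [MELL.PreNet.canonicalIndexing_eq _ (MELL.PreNet.isCanonical_depthIndex hπ.1 hm.2 hp hc),
      MELL.PreNet.depthIndex_of_not_isDischarged hd, (π.mem_concl e l).1 he]
  · have hI := MELL.PreNet.isCanonical_canonicalIndexing h
    have hl' := fun e hd => hl (π.src e) e ((π.mem_concl e _).2 rfl) hd
    exact ⟨⟨hπ, hI.1.1.depthStratified hl'⟩, hI.1.1.paragraphFree hl',
      hI.componentsMeetDepthZero hπ.1 hl'⟩
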